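/- Let $x_1,\dots,x_n$ be points of a set $\mathbb X$ (the treatments), let $\bar x_1,\dots,\bar x_q$ be their distinct values, each listed once, and put $d=n-q$. Let $f:\mathbb X\to\mathbb R^p$ be a function, $F$ the $n\times p$ matrix with $i$th row $f(x_i)^{T}$, and $Z$ the $n\times q$ matrix with $Z_{ij}=1$ if $x_i=\bar x_j$ and $Z_{ij}=0$ otherwise. For a matrix $A$ with $A^TA$ invertible write $H_A=A(A^TA)^{-1}A^T$; the matrix $Z^TZ$ is always invertible. Let $\bar\mu\in\mathbb R^q$, $\kappa>0$, let $\mathbf y\sim \mathrm N(Z\bar\mu,\kappa I_n)$, and write $Q=\mathbf y^T(I_n-H_Z)\mathbf y$. Then: (i) if $F^TF$ is invertible, then $\mathbf y^TH_F\mathbf y$ and $Q$ are independent; (ii) $F^T\mathbf y$ and $Q$ are independent; (iii) $Q/\kappa\sim\chi^2_d$, the law of the sum of squares of $d$ independent standard normal variables (the point mass at $0$ if $d=0$); (iv) if $d>2$, then $1/Q$ is integrable and $\mathrm E[1/Q]=\dfrac{1}{\kappa(d-2)}$; if $d>0$, then $\log Q$ is integrable and $\mathrm E[\log Q]=\log\kappa+\log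 2+\psi(d/2)$, where $\psi=\Gamma'/\Gamma$ is the digamma function. -/

import Mathlib

open MeasureTheory ProbabilityTheory Matrix

/-- `xbar` lists the distinct values of the treatments `x 1, …, x n`, each exactly once. -/
structure IsUniqueTreatments {𝕏 : Type*} {n q : ℕ} (x : Fin n → 𝕏) (xbar : Fin q → 𝕏) :
    Prop where
  injective : Function.Injective xbar
  range_eq : Set.range xbar = Set.range x

/-- Model matrix `F` of the linear model: its `i`th row is `f (x i)`. -/
def modelMatrix {𝕏 : Type*} {n p : ℕ} (f : 𝕏 → Fin p → ℝ) (x : Fin n → 𝕏) :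
    Matrix (Fin n) (Fin p) ℝ :=
  Matrix.of fun i => f (x i)

/-- Model matrix `Z` of the unique-treatment model: `Z i j = 1` if `x i = xbar j`, else `0`. -/
def treatmentMatrix {𝕏 : Type*} [DecidableEq 𝕏] {n q : ℕ} (x : Fin n → 𝕏) (xbar : Fin q → 𝕏) :
    Matrix (Fin n) (Fin q) ℝ :=
  Matrix.of fun i j => if x i = xbar j then 1 else 0

/-- The hat matrix `H_A = A (Aᵀ A)⁻¹ Aᵀ` (meaningful when `Aᵀ A` is invertible). -/
noncomputable def hatMatrix {n m : ℕ} (A : Matrix (Fin n) (Fin m) ℝ) :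
    Matrix (Fin n) (Fin n) ℝ :=
  A * (Aᵀ * A)⁻¹ * Aᵀ

/-- The quadratic form `‖u‖_V = uᵀ V u`. -/
noncomputable def quadForm {n : ℕ} (V : Matrix (Fin n) (Fin n) ℝ)
    (u : EuclideanSpace ℝ (Fin n)) : ℝ :=
  u.ofLp ⬝ᵥ (V *ᵥ u.ofLp)

/-- The `χ²_d` distribution: the law of the sum of squares of `d` independent standard normal
variables (for `d = 0` the point mass at `0`). -/
noncomputable def chiSquared (d : ℕ) : Measure ℝ :=
  (Measure.pi fun _ : Fin d => gaussianReal 0 1).map fun z => ∑ i, z i ^ 2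

/-- The pure-error quadratic form `u ↦ uᵀ (I_n - H_Z) u`. -/
noncomputable def pureErrorForm {𝕏 : Type*} [DecidableEq 𝕏] {n q : ℕ}
    (x : Fin n → 𝕏) (xbar : Fin q → 𝕏) (u : EuclideanSpace ℝ (Fin n)) : ℝ :=
  quadForm (1 - hatMatrix (treatmentMatrix x xbar)) u

/-! `H_Z` is the orthogonal projection onto the column space `W` of `Z`, so `Q` is the squared norm
of the projection of `y` onto `Wᗮ`. The mean lies in `W`, hence that projection is centred, and
divided by `√κ` it is standard Gaussian in dimension `n - q`: this gives the chi-squared law. Since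
`F = Z * B`, where `B` has rows `f (xbar j)`, `Fᵀ y` depends on `y` only through its projection onto
`W`, which is uncorrelated with, hence independent of, the projection onto `Wᗮ`. The form `yᵀ H_F y`
is a function of `Fᵀ y`.

For the expectations, chi-squared is identified with a gamma law (`chiSquared_eq_gammaMeasure`),
where the inverse moment is a ratio of Gamma values and the logarithmic moment is a derivative of a
Mellin transform. -/

/-! ### Moments of the gamma distribution -/

lemma gammaMeasure_integrable_iff {a r : ℝ} (ha : 0 < a) (hr : 0 < r) {g : ℝ → ℝ} :
    Integrable g (gammaMeasure a r) ↔
      IntegrableOn (fun x => x ^ (a - 1) * Real.exp (-(r * x)) * g x) (Set.Ioi 0) := by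
  have hc : r ^ a / Real.Gamma a ≠ 0 :=
    (div_pos (Real.rpow_pos_of_pos hr a) (Real.Gamma_pos_of_pos ha)).ne'
  rw [gammaMeasure, integrable_withDensity_iff_integrable_smul' (by unfold gammaPDF; fun_prop)
    (ae_of_all _ fun _ => by simp [gammaPDF]), ← integrableOn_Ici_iff_integrableOn_Ioi,
    ← integrable_indicator_iff measurableSet_Ici, 
    ← integrable_const_mul_iff (f := Set.indicator _ _) hc.isUnit]
  refine integrable_congr (ae_of_all _ fun x => ?_)
  dsimp only
  rw [show gammaPDF a r x = ENNReal.ofReal (gammaPDFReal a r x) from rfl,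
    ENNReal.toReal_ofReal (gammaPDFReal_nonneg ha hr x), gammaPDFReal]
  by_cases hx : 0 ≤ x
  · simp [hx, mul_assoc]
  · simp [hx]

lemma integral_gammaMeasure {a r : ℝ} (ha : 0 < a) (hr : 0 < r) (g : ℝ → ℝ) :
    ∫ x, g x ∂(gammaMeasure a r) =
      r ^ a / Real.Gamma a * ∫ x in Set.Ioi 0, x ^ (a - 1) * Real.exp (-(r * x)) * g x := by
  rw [gammaMeasure, integral_withDensity_eq_integral_toReal_smul (by unfold gammaPDF; fun_prop)
    (ae_of_all _ fun _ => by simp [gammaPDF]), ← integral_Ici_eq_integral_Ioi,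
    ← integral_indicator measurableSet_Ici, ← integral_const_mul]
  refine integral_congr_ae (ae_of_all _ fun x => ?_)
  dsimp only
  rw [show gammaPDF a r x = ENNReal.ofReal (gammaPDFReal a r x) from rfl,
    ENNReal.toReal_ofReal (gammaPDFReal_nonneg ha hr x), gammaPDFReal]
  by_cases hx : 0 ≤ x
  · simp [hx, mul_assoc]
  · simp [hx]

lemma integrable_inv_gammaMeasure {a r : ℝ} (ha : 1 < a) (hr : 0 < r) :
    Integrable (fun x => x⁻¹) (gammaMeasure a r) := by
  rw [gammaMeasure_integrable_iff (by linarith) hr]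
  have h := integrableOn_rpow_mul_exp_neg_mul_rpow (s := a - 2) (p := 1) (b := r) (by linarith)
    one_pos hr
  refine h.congr_fun (fun x (hx : 0 < x) => ?_) measurableSet_Ioi
  dsimp only
  rw [show a - 1 = (a - 2) + 1 by ring, Real.rpow_add_one hx.ne']
  simp
  field_simp

lemma integral_inv_gammaMeasure {a r : ℝ} (ha : 1 < a) (hr : 0 < r) :
    ∫ x, x⁻¹ ∂(gammaMeasure a r) = r / (a - 1) := by
  rw [integral_gammaMeasure (by linarith) hr]
  have h := Real.integral_rpow_mul_exp_neg_mul_Ioi (a := a - 1) (r := r) (by linarith) hr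
  have h2 : ∫ x in Set.Ioi (0 : ℝ), x ^ (a - 1) * Real.exp (-(r * x)) * x⁻¹ =
      ∫ x in Set.Ioi (0 : ℝ), x ^ (a - 1 - 1) * Real.exp (-(r * x)) := by
    refine setIntegral_congr_fun measurableSet_Ioi fun x (hx : 0 < x) => ?_
    rw [Real.rpow_sub_one hx.ne' (a - 1)]
    field_simp
  have hΓ := Real.Gamma_add_one (s := a - 1) (by linarith)
  rw [sub_add_cancel] at hΓ
  have hΓ0 : Real.Gamma (a - 1) ≠ 0 := (Real.Gamma_pos_of_pos (by linarith)).ne'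
  have ha' : a - 1 ≠ 0 := by linarith
  have hr' : r ^ (a - 1) ≠ 0 := (Real.rpow_pos_of_pos hr _).ne'
  rw [h2, h, hΓ, one_div, Real.inv_rpow hr.le, show r ^ a = r ^ (a - 1) * r by
    rw [← Real.rpow_add_one hr.ne', sub_add_cancel]]
  field_simp

/-- Differentiating `t ^ (s - 1)` in `s` produces `log t`, so this is the derivative at `a` of the
Mellin transform `(1 / r) ^ s * Γ(s)` of `exp (-(r * t))`. -/
lemma mellin_log_mul_exp_neg_mul {a r : ℝ} (ha : 0 < a) (hr : 0 < r) :
    MellinConvergent (fun t : ℝ => Real.log t • (Real.exp (-(r * t)) : ℂ)) a ∧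
      mellin (fun t : ℝ => Real.log t • (Real.exp (-(r * t)) : ℂ)) a =
        (1 / r : ℂ) ^ (a : ℂ) * Complex.Gamma a *
          (Complex.digamma a - Real.log r) := by
  have hs : 0 < (a : ℂ).re := by simpa using ha
  have hcont : Continuous fun t : ℝ => (Real.exp (-(r * t)) : ℂ) := by fun_prop
  -- The decay exponents `a + 1` at infinity and `0` at the origin give a strip containing `a`.
  obtain ⟨h1, h2⟩ := mellin_hasDerivAt_of_isBigO_rpow (E := ℂ) (a := a + 1) (b := 0)
    (f := fun t : ℝ => (Real.exp (-(r * t)) : ℂ)) (s := a)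
    (hcont.continuousOn.locallyIntegrableOn measurableSet_Ioi) (by
      rw [← Asymptotics.isBigO_norm_left]
      simp_rw [Complex.norm_real, Asymptotics.isBigO_norm_left]
      simpa only [neg_mul] using (isLittleO_exp_neg_mul_rpow_atTop hr _).isBigO)
    (by simp) (by
      simp_rw [neg_zero, Real.rpow_zero]
      refine Asymptotics.isBigO_const_of_tendsto (y := (1 : ℂ)) ?_ one_ne_zero
      have := hcont.continuousWithinAt (s := Set.Ioi 0) (x := 0)
      simpa [ContinuousWithinAt] using this) hs
  refine ⟨h1, ?_⟩
  have hr0 : (1 / r : ℂ) ≠ 0 := by simpa using hr.ne'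
  have hΓ0 : Complex.Gamma a ≠ 0 := Complex.Gamma_ne_zero_of_re_pos hs
  have hΓ : HasDerivAt Complex.Gamma (deriv Complex.Gamma a) (a : ℂ) :=
    (Complex.differentiableAt_Gamma _ fun m h => by
      rw [h] at hs; simp at hs; linarith [m.cast_nonneg (α := ℝ)]).hasDerivAt
  have h3 := ((hasDerivAt_id (a : ℂ)).const_cpow (c := (1 / r : ℂ)) (Or.inl hr0)).mul hΓ
  have h4 : mellin (fun t : ℝ => (Real.exp (-(r * t)) : ℂ)) =ᶠ[nhds (a : ℂ)]
      fun s => (1 / r : ℂ) ^ s * Complex.Gamma s := by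
    filter_upwards [(isOpen_lt continuous_const Complex.continuous_re).mem_nhds hs] with s hs'
    rw [mellin, ← Complex.integral_cpow_mul_exp_neg_mul_Ioi hs' (by simpa using hr)]
    simp
  have h5 := h2.unique (h3.congr_of_eventuallyEq h4)
  rw [h5, Complex.digamma_def, logDeriv_apply]
  have hlog : Complex.log (1 / r) = -(Real.log r : ℂ) := by
    rw [one_div, ← Complex.ofReal_inv, ← Complex.ofReal_log (by positivity), Real.log_inv]
    simp
  simp only [id, hlog]
  field_simp
  ring

lemma ofReal_rpow_mul_exp_mul_log {a r x : ℝ} (hx : 0 < x) :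
    (x : ℂ) ^ ((a : ℂ) - 1) • (Real.log x • (Real.exp (-(r * x)) : ℂ)) =
      ((x ^ (a - 1) * Real.exp (-(r * x)) * Real.log x : ℝ) : ℂ) := by
  rw [Complex.real_smul, smul_eq_mul, Complex.ofReal_mul, Complex.ofReal_mul,
    Complex.ofReal_cpow hx.le]
  push_cast
  ring

lemma integrable_log_gammaMeasure {a r : ℝ} (ha : 0 < a) (hr : 0 < r) :
    Integrable Real.log (gammaMeasure a r) := by
  rw [gammaMeasure_integrable_iff ha hr]
  have h := (mellin_log_mul_exp_neg_mul ha hr).1.re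
  refine IntegrableOn.congr_fun h (fun x (hx : 0 < x) => ?_) measurableSet_Ioi
  simp only [ofReal_rpow_mul_exp_mul_log hx]
  exact Complex.ofReal_re _

lemma integral_log_gammaMeasure {a r : ℝ} (ha : 0 < a) (hr : 0 < r) :
    ((∫ x, Real.log x ∂(gammaMeasure a r) : ℝ) : ℂ) = Complex.digamma a - Real.log r := by
  have h := (mellin_log_mul_exp_neg_mul ha hr).2
  rw [integral_gammaMeasure ha hr, Complex.ofReal_mul, ← integral_complex_ofReal]
  have h2 : ∫ x in Set.Ioi (0 : ℝ), ((x ^ (a - 1) * Real.exp (-(r * x)) * Real.log x : ℝ) : ℂ) =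
      mellin (fun t : ℝ => Real.log t • (Real.exp (-(r * t)) : ℂ)) a := by
    refine setIntegral_congr_fun measurableSet_Ioi fun x (hx : 0 < x) => ?_
    exact (ofReal_rpow_mul_exp_mul_log hx).symm
  have hΓ0 : Complex.Gamma a ≠ 0 := Complex.Gamma_ne_zero_of_re_pos (by simpa using ha)
  have hr0 : (r : ℂ) ^ (a : ℂ) ≠ 0 := by simp [Complex.cpow_eq_zero_iff, hr.ne']
  have h3 : (1 / r : ℂ) ^ (a : ℂ) = ((r : ℂ) ^ (a : ℂ))⁻¹ := by
    rw [one_div, Complex.inv_cpow _ _ (by simpa [Complex.arg_ofReal_of_nonneg hr.le] using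
      Real.pi_pos.ne)]
  rw [h2, h, Complex.ofReal_div, Complex.ofReal_cpow hr.le, ← Complex.Gamma_ofReal, h3]
  field_simp

lemma mgf_id_gammaMeasure {a r : ℝ} (ha : 0 < a) (hr : 0 < r) (t : ℝ) :
    mgf id (gammaMeasure a r) t = if t < r then (r / (r - t)) ^ a else 0 := by
  have hexp : ∀ x : ℝ, x ^ (a - 1) * Real.exp (-(r * x)) * Real.exp (t * x) =
      x ^ (a - 1) * Real.exp (-((r - t) * x)) := fun x => by
    rw [mul_assoc, ← Real.exp_add]; ring_nf
  split_ifs with ht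
  · have hrt : 0 < r - t := sub_pos.2 ht
    have hΓ := Real.Gamma_pos_of_pos ha
    simp only [mgf, id]
    rw [integral_gammaMeasure ha hr]
    simp_rw [hexp]
    rw [Real.integral_rpow_mul_exp_neg_mul_Ioi ha hrt, Real.div_rpow hr.le hrt.le,
      Real.div_rpow zero_le_one hrt.le, Real.one_rpow]
    field_simp
  · refine integral_undef fun h => ?_
    simp only [id] at h
    rw [gammaMeasure_integrable_iff ha hr] at h
    simp_rw [hexp] at h
    -- For `t ≥ r` the integrand dominates `x ^ (a - 1)` on `(1, ∞)`, which is not integrable as `a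
    -- > 0`; the integral then takes its default value `0`.
    have h1 : IntegrableOn (fun x : ℝ => x ^ (a - 1)) (Set.Ioi 1) := by
      refine (h.mono_set (Set.Ioi_subset_Ioi zero_le_one)).mono' (by fun_prop) ?_
      refine (ae_restrict_iff' measurableSet_Ioi).2 (ae_of_all _ fun x (hx : 1 < x) => ?_)
      have hx0 : 0 < x := one_pos.trans hx
      rw [Real.norm_of_nonneg (by positivity)]
      refine le_mul_of_one_le_right (by positivity) (Real.one_le_exp ?_)
      nlinarith
    rw [integrableOn_Ioi_rpow_iff one_pos] at h1
    linarith

/-! ### Chi-squared as a gamma law -/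

lemma integral_exp_mul_sq_gaussianReal (t : ℝ) :
    ∫ x, Real.exp (t * x ^ 2) ∂(gaussianReal 0 1) =
      if t < 1 / 2 then (1 / 2 / (1 / 2 - t)) ^ (1 / 2 : ℝ) else 0 := by
  rw [integral_gaussianReal_eq_integral_smul one_ne_zero]
  have h1 : ∀ x : ℝ, gaussianPDFReal 0 1 x • Real.exp (t * x ^ 2) =
      (√(2 * Real.pi))⁻¹ * Real.exp (-(1 / 2 - t) * x ^ 2) := by
    intro x
    rw [gaussianPDFReal, show -(1 / 2 - t) * x ^ 2 = -(x - 0) ^ 2 / (2 * 1) + t * x ^ 2 by ring,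
      Real.exp_add]
    simp [mul_assoc]
  simp_rw [h1]
  rw [integral_const_mul, integral_gaussian]
  split_ifs with ht
  · have hrt : 0 < 1 / 2 - t := sub_pos.2 ht
    have := Real.sqrt_pos.2 Real.pi_pos
    have := Real.sqrt_pos.2 hrt
    rw [← Real.sqrt_eq_rpow, Real.sqrt_div' _ hrt.le, Real.sqrt_div' _ hrt.le,
      Real.sqrt_mul two_pos.le, Real.sqrt_div' _ two_pos.le, Real.sqrt_one]
    field_simp
  · rw [Real.sqrt_eq_zero_of_nonpos
      (div_nonpos_of_nonneg_of_nonpos Real.pi_pos.le (by linarith)), mul_zero]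

/-- The moment generating functions agree on all of `ℝ`, default values included. Being finite near
`0`, they extend analytically to a vertical strip, and on the imaginary axis they are the
characteristic functions. -/
lemma chiSquared_eq_gammaMeasure {d : ℕ} (hd : 0 < d) :
    chiSquared d = gammaMeasure (d / 2) (1 / 2) := by
  have ha : (0 : ℝ) < d / 2 := by positivity
  have := isProbabilityMeasure_gammaMeasure ha (one_half_pos (α := ℝ))
  have hm : Measurable fun z : Fin d → ℝ => ∑ i, z i ^ 2 := by fun_prop
  have : IsProbabilityMeasure (chiSquared d) := Measure.isProbabilityMeasure_map hm.aemeasurable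
  have hmgf : mgf id (chiSquared d) = mgf id (gammaMeasure (d / 2) (1 / 2)) := by
    funext t
    rw [mgf_id_gammaMeasure ha one_half_pos, mgf, chiSquared,
      integral_map hm.aemeasurable (by fun_prop)]
    simp_rw [id, Finset.mul_sum, Real.exp_sum]
    rw [integral_fintype_prod_eq_prod (f := fun _ (x : ℝ) => Real.exp (t * x ^ 2))]
    simp_rw [integral_exp_mul_sq_gaussianReal]
    rw [Finset.prod_const, Finset.card_univ, Fintype.card_fin]
    split_ifs with ht
    · have : 0 < 1 / 2 - t := sub_pos.2 ht
      rw [← Real.rpow_mul_natCast (by positivity)]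
      ring_nf
    · exact zero_pow hd.ne'
  have h0 : (0 : ℝ) ∈ interior (integrableExpSet id (chiSquared d)) := by
    rw [mem_interior_iff_mem_nhds]
    filter_upwards [Iio_mem_nhds (one_half_pos (α := ℝ))] with t ht
    -- Non-integrability would force the value `0`, whereas the gamma formula is positive for `t < 1
    -- / 2`.
    by_contra h
    have h1 : mgf id (chiSquared d) t = 0 := integral_undef h
    rw [hmgf, mgf_id_gammaMeasure ha one_half_pos, if_pos (Set.mem_Iio.1 ht)] at h1
    have : 0 < 1 / 2 - t := sub_pos.2 ht
    exact (by positivity : (1 / 2 / (1 / 2 - t)) ^ ((d : ℝ) / 2) ≠ 0) h1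
  refine Measure.ext_of_charFun (funext fun t => ?_)
  rw [← complexMGF_id_mul_I, ← complexMGF_id_mul_I]
  exact eqOn_complexMGF_of_mgf hmgf (by simpa using h0)

/-- The law of the squared norm of a standard Gaussian vector. -/
lemma map_norm_sq_stdGaussian {E : Type*} [NormedAddCommGroup E] [InnerProductSpace ℝ E]
    [FiniteDimensional ℝ E] [MeasurableSpace E] [BorelSpace E] :
    (stdGaussian E).map (fun v => ‖v‖ ^ 2) = chiSquared (Module.finrank ℝ E) := by
  rw [stdGaussian, Measure.map_map (by fun_prop) (by fun_prop), chiSquared]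
  congr 1
  funext z
  have h := (stdOrthonormalBasis ℝ E).sum_sq_norm_inner_right
    (∑ i, z i • stdOrthonormalBasis ℝ E i)
  simp only [Function.comp_apply]
  rw [← h]
  simp [(stdOrthonormalBasis ℝ E).orthonormal.inner_right_fintype]

/-- A subspace projection of an isotropic Gaussian vector whose mean is orthogonal to the subspace
is, up to scaling, standard Gaussian. -/
lemma map_orthogonalProjectionOnto_multivariateGaussian {n : ℕ}
    (V : Submodule ℝ (EuclideanSpace ℝ (Fin n))) {m : EuclideanSpace ℝ (Fin n)} (hm : m ∈ Vᗮ)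
    {κ : ℝ} (hκ : 0 < κ) :
    (multivariateGaussian m (κ • (1 : Matrix (Fin n) (Fin n) ℝ))).map
      (fun u => (√κ)⁻¹ • V.orthogonalProjectionOnto u) = stdGaussian V := by
  have hS : (κ • (1 : Matrix (Fin n) (Fin n) ℝ)).PosSemidef := PosSemidef.one.smul hκ.le
  have hmeas : Measurable fun u => (√κ)⁻¹ • V.orthogonalProjectionOnto u := by fun_prop
  have := Measure.isProbabilityMeasure_map
    (μ := multivariateGaussian m (κ • (1 : Matrix (Fin n) (Fin n) ℝ))) hmeas.aemeasurable
  refine Measure.ext_of_charFun (funext fun t => ?_)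
  have h1 := charFun_multivariateGaussian (μ := m) hS ((√κ)⁻¹ • (t : EuclideanSpace ℝ (Fin n)))
  rw [charFun_stdGaussian, charFun_apply, integral_map hmeas.aemeasurable (by fun_prop)]
  rw [charFun_apply] at h1
  -- Self-adjointness of the projection turns the characteristic function at `t` into that of the
  -- original vector at `t / √κ`.
  have h2 : ∀ u, inner ℝ ((√κ)⁻¹ • V.orthogonalProjectionOnto u) t =
      inner ℝ u ((√κ)⁻¹ • (t : EuclideanSpace ℝ (Fin n))) := fun u => by
    rw [real_inner_smul_left, real_inner_smul_right, 
      Submodule.inner_orthogonalProjectionOnto_eq_of_mem_right]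
  simp_rw [h2, h1]
  have h3 : inner ℝ ((√κ)⁻¹ • (t : EuclideanSpace ℝ (Fin n))) m = 0 := by
    rw [real_inner_smul_left, hm t t.2, mul_zero]
  have h4 : (t : EuclideanSpace ℝ (Fin n)).ofLp ⬝ᵥ (t : EuclideanSpace ℝ (Fin n)).ofLp =
      ‖t‖ ^ 2 := by
    rw [Submodule.coe_norm, EuclideanSpace.real_norm_sq_eq]
    simp [dotProduct, sq]
  have h5 : (√κ)⁻¹ * (κ * (√κ)⁻¹) = 1 := by
    have := Real.sqrt_pos.2 hκ
    field_simp
    exact (Real.sq_sqrt hκ.le).symm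
  rw [h3]
  congr 1
  simp only [smul_mulVec, one_mulVec, dotProduct_smul, smul_dotProduct, WithLp.ofLp_smul, h4,
    smul_eq_mul]
  rw [show κ * ((√κ)⁻¹ * ((√κ)⁻¹ * ‖t‖ ^ 2)) = (√κ)⁻¹ * (κ * (√κ)⁻¹) * ‖t‖ ^ 2 by ring, h5]
  push_cast
  ring

/-- The projections of an isotropic Gaussian vector onto a subspace and its orthogonal complement
are independent. -/
lemma indepFun_starProjection_orthogonal {n : ℕ} {Ω : Type*} [MeasurableSpace Ω] {P : Measure Ω}
    {y : Ω → EuclideanSpace ℝ (Fin n)} {m : EuclideanSpace ℝ (Fin n)} {κ : ℝ} (hκ : 0 ≤ κ)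
    (hy : HasLaw y (multivariateGaussian m (κ • (1 : Matrix (Fin n) (Fin n) ℝ))) P)
    (W : Submodule ℝ (EuclideanSpace ℝ (Fin n))) :
    IndepFun (fun ω => W.starProjection (y ω)) (fun ω => Wᗮ.starProjection (y ω)) P := by
  have hS : (κ • (1 : Matrix (Fin n) (Fin n) ℝ)).PosSemidef := PosSemidef.one.smul hκ
  have hG : HasGaussianLaw y P := ⟨by rw [hy.map_eq]; infer_instance⟩
  -- Both projections are linear images of one Gaussian vector, so they are jointly Gaussian and
  -- vanishing covariance suffices.
  refine (hG.map (W.starProjection.prod Wᗮ.starProjection)).indepFun_of_covariance_inner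
    (X := fun ω => W.starProjection (y ω)) (Y := fun ω => Wᗮ.starProjection (y ω)) fun s t => ?_
  simp_rw [← Submodule.inner_starProjection_left_eq_right]
  rw [hy.covariance_fun_comp (f := fun v => inner ℝ (W.starProjection s) v)
    (g := fun v => inner ℝ (Wᗮ.starProjection t) v) (by fun_prop) (by fun_prop),
    ← covarianceBilin_apply_eq_cov IsGaussian.memLp_two_id,
    covarianceBilin_multivariateGaussian hS, smul_mulVec, one_mulVec, dotProduct_smul]
  have h := Submodule.inner_right_of_mem_orthogonal (W.starProjection_apply_mem s)
    (Wᗮ.starProjection_apply_mem t)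
  rw [EuclideanSpace.inner_eq_star_dotProduct, star_trivial, dotProduct_comm] at h
  rw [h, smul_zero]

/-! ### Hat matrices as orthogonal projections -/

section HatMatrix

variable {n m : ℕ} {A : Matrix (Fin n) (Fin m) ℝ}

lemma transpose_mul_hatMatrix (hA : IsUnit (Aᵀ * A)) : Aᵀ * hatMatrix A = Aᵀ := by
  rw [hatMatrix, ← Matrix.mul_assoc, ← Matrix.mul_assoc,
    mul_nonsing_inv _ ((isUnit_iff_isUnit_det _).1 hA), Matrix.one_mul]

/-- `1 - H_A` is the projection onto the orthogonal complement of the range of `A`. -/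
lemma starProjection_orthogonal_range (hA : IsUnit (Aᵀ * A)) (u : EuclideanSpace ℝ (Fin n)) :
    (LinearMap.range (toEuclideanLin A))ᗮ.starProjection u =
      WithLp.toLp 2 ((1 - hatMatrix A) *ᵥ u.ofLp) := by
  refine Submodule.eq_starProjection_of_mem_orthogonal ?_ ?_
  · rw [Submodule.mem_orthogonal]
    rintro _ ⟨v, rfl⟩
    rw [EuclideanSpace.inner_eq_star_dotProduct, star_trivial, ofLp_toLpLin, toLin'_apply,
      dotProduct_comm, ← vecMul_transpose, ← dotProduct_mulVec, mulVec_mulVec, Matrix.mul_sub,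
      transpose_mul_hatMatrix hA]
    simp
  · refine Submodule.le_orthogonal_orthogonal _
      ⟨WithLp.toLp 2 (((Aᵀ * A)⁻¹ * Aᵀ) *ᵥ u.ofLp), ?_⟩
    ext i
    simp [hatMatrix, sub_mulVec, Matrix.mul_assoc]

lemma starProjection_range (hA : IsUnit (Aᵀ * A)) (u : EuclideanSpace ℝ (Fin n)) :
    (LinearMap.range (toEuclideanLin A)).starProjection u =
      WithLp.toLp 2 (hatMatrix A *ᵥ u.ofLp) := by
  have h := Submodule.starProjection_orthogonal_val (K := LinearMap.range (toEuclideanLin A)) u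
  rw [starProjection_orthogonal_range hA, eq_sub_iff_add_eq'] at h
  rw [eq_sub_of_add_eq h]
  ext i
  simp [sub_mulVec]

lemma quadForm_one_sub_hatMatrix (hA : IsUnit (Aᵀ * A)) (u : EuclideanSpace ℝ (Fin n)) :
    quadForm (1 - hatMatrix A) u =
      ‖(LinearMap.range (toEuclideanLin A))ᗮ.orthogonalProjectionOnto u‖ ^ 2 := by
  rw [← Submodule.re_inner_starProjection_eq_normSq, starProjection_orthogonal_range hA, quadForm,
    EuclideanSpace.inner_eq_star_dotProduct]
  simp

lemma injective_mulVec (hA : IsUnit (Aᵀ * A)) : Function.Injective A.mulVec := by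
  intro v w h
  refine mulVec_injective_iff_isUnit.2 hA ?_
  simp only [← mulVec_mulVec]
  rw [h]

lemma finrank_orthogonal_range (hA : IsUnit (Aᵀ * A)) :
    m + Module.finrank ℝ ↥(LinearMap.range (toEuclideanLin A))ᗮ = n := by
  have h := Submodule.finrank_add_finrank_orthogonal (LinearMap.range (toEuclideanLin A))
  have hinj : Function.Injective (toEuclideanLin A) := fun v w h =>
    (WithLp.ofLp_injective 2) (injective_mulVec hA (by simpa using congrArg WithLp.ofLp h))
  rwa [LinearMap.finrank_range_of_inj hinj, finrank_euclideanSpace_fin,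
    finrank_euclideanSpace_fin] at h

end HatMatrix

/-! ### The treatment matrix -/

section Treatment

variable {𝕏 : Type*} [DecidableEq 𝕏] {n q p : ℕ} {x : Fin n → 𝕏} {xbar : Fin q → 𝕏}

/-- Each `xbar j` occurs as some `x i`, and row `i` of `Z *ᵥ v` reads off `v j`; so `Z` is injective
and its Gram matrix positive definite. -/
lemma isUnit_transpose_mul_treatmentMatrix (hx : IsUniqueTreatments x xbar) :
    IsUnit ((treatmentMatrix x xbar)ᵀ * treatmentMatrix x xbar) := by
  have hinj : Function.Injective (treatmentMatrix x xbar).mulVec := by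
    intro v w h
    funext j
    obtain ⟨i, hi⟩ : xbar j ∈ Set.range x := hx.range_eq ▸ Set.mem_range_self j
    have := congrFun h i
    simpa [mulVec, dotProduct, treatmentMatrix, hi, hx.injective.eq_iff] using this
  have := PosDef.conjTranspose_mul_self _ hinj
  rw [conjTranspose_eq_transpose_of_trivial] at this
  exact this.isUnit

lemma modelMatrix_eq_treatmentMatrix_mul (hx : IsUniqueTreatments x xbar)
    (f : 𝕏 → Fin p → ℝ) :
    modelMatrix f x = treatmentMatrix x xbar * modelMatrix f xbar := by
  ext i k
  obtain ⟨j, hj⟩ : x i ∈ Set.range xbar := hx.range_eq ▸ Set.mem_range_self i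
  simp [modelMatrix, treatmentMatrix, mul_apply, ← hj, hx.injective.eq_iff]

end Treatment

lemma quadForm_hatMatrix {n m : ℕ} (A : Matrix (Fin n) (Fin m) ℝ) (u : EuclideanSpace ℝ (Fin n)) :
    quadForm (hatMatrix A) u = (Aᵀ *ᵥ u.ofLp) ⬝ᵥ ((Aᵀ * A)⁻¹ *ᵥ (Aᵀ *ᵥ u.ofLp)) := by
  rw [quadForm, hatMatrix, ← mulVec_mulVec, ← mulVec_mulVec, dotProduct_mulVec, mulVec_transpose]

lemma ProbabilityTheory.HasLaw.integrable_comp {Ω : Type*} [MeasurableSpace Ω] {P : Measure Ω}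
    {X : Ω → ℝ} {μ : Measure ℝ} (hX : HasLaw X μ P) {g : ℝ → ℝ} (hg : Integrable g μ) :
    Integrable (fun ω => g (X ω)) P := by
  rw [← hX.map_eq] at hg
  exact hg.comp_aemeasurable hX.aemeasurable

lemma hasLaw_quadForm_div_chiSquared {n m d : ℕ} {A : Matrix (Fin n) (Fin m) ℝ}
    (hA : IsUnit (Aᵀ * A)) (hd : m + d = n) (v : Fin m → ℝ) {κ : ℝ} (hκ : 0 < κ)
    {Ω : Type*} [MeasurableSpace Ω] {P : Measure Ω} {y : Ω → EuclideanSpace ℝ (Fin n)}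
    (hy : HasLaw y (multivariateGaussian (WithLp.toLp 2 (A *ᵥ v))
      (κ • (1 : Matrix (Fin n) (Fin n) ℝ))) P) :
    HasLaw (fun ω => quadForm (1 - hatMatrix A) (y ω) / κ) (chiSquared d) P := by
  set W := LinearMap.range (toEuclideanLin A) with hW
  have hmean : WithLp.toLp 2 (A *ᵥ v) ∈ Wᗮᗮ :=
    Submodule.le_orthogonal_orthogonal _ ⟨WithLp.toLp 2 v, by ext i; simp⟩
  have hdim : Module.finrank ℝ ↥Wᗮ = d := by
    have := finrank_orthogonal_range hA
    rw [← hW] at this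
    omega
  have hproj : HasLaw (fun u => (√κ)⁻¹ • Wᗮ.orthogonalProjectionOnto u) (stdGaussian Wᗮ)
      (multivariateGaussian (WithLp.toLp 2 (A *ᵥ v)) (κ • (1 : Matrix (Fin n) (Fin n) ℝ))) :=
    ⟨by fun_prop, map_orthogonalProjectionOnto_multivariateGaussian Wᗮ hmean hκ⟩
  have hnorm : HasLaw (fun w => ‖w‖ ^ 2) (chiSquared d) (stdGaussian Wᗮ) :=
    ⟨by fun_prop, by rw [map_norm_sq_stdGaussian, hdim]⟩
  refine (hnorm.comp (hproj.comp hy)).congr (Filter.EventuallyEq.of_eq (funext fun ω => ?_))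
  simp only [Function.comp_apply]
  rw [quadForm_one_sub_hatMatrix hA, norm_smul, mul_pow, norm_inv,
    Real.norm_of_nonneg (Real.sqrt_nonneg κ), inv_pow, Real.sq_sqrt hκ.le]
  ring

/-- As `Aᵀ * H_A = Aᵀ`, the linear statistic sees only the projection onto the range of `A`, and the
quadratic form only the complementary one. -/
lemma indepFun_mulVec_quadForm {n m p : ℕ} {A : Matrix (Fin n) (Fin m) ℝ}
    (hA : IsUnit (Aᵀ * A)) (B : Matrix (Fin m) (Fin p) ℝ) {μ : EuclideanSpace ℝ (Fin n)} {κ : ℝ}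
    (hκ : 0 ≤ κ) {Ω : Type*} [MeasurableSpace Ω] {P : Measure Ω}
    {y : Ω → EuclideanSpace ℝ (Fin n)}
    (hy : HasLaw y (multivariateGaussian μ (κ • (1 : Matrix (Fin n) (Fin n) ℝ))) P) :
    IndepFun (fun ω => (A * B)ᵀ *ᵥ (y ω).ofLp)
      (fun ω => quadForm (1 - hatMatrix A) (y ω)) P := by
  have h := (indepFun_starProjection_orthogonal hκ hy (LinearMap.range (toEuclideanLin A))).comp
    (φ := fun u => (A * B)ᵀ *ᵥ u.ofLp) (ψ := fun u => ‖u‖ ^ 2)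
    (by fun_prop) (by fun_prop)
  refine h.congr (Filter.EventuallyEq.of_eq (funext fun ω => ?_))
    (Filter.EventuallyEq.of_eq (funext fun ω => ?_))
  · simp only [Function.comp_apply]
    rw [starProjection_range hA, mulVec_mulVec, transpose_mul, Matrix.mul_assoc,
      transpose_mul_hatMatrix hA]
  · simp only [Function.comp_apply]
    rw [quadForm_one_sub_hatMatrix hA, Submodule.starProjection_apply, Submodule.coe_norm]

/-! ### Inverse and logarithmic moments -/

section ScaledChiSquared

variable {Ω : Type*} [MeasurableSpace Ω] {P : Measure Ω} {Q : Ω → ℝ} {κ : ℝ} {d : ℕ}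

lemma integrable_one_div_and_integral_eq (hκ : 0 < κ) (hd : 2 < d)
    (hQ : HasLaw (fun ω => Q ω / κ) (chiSquared d) P) :
    Integrable (fun ω => 1 / Q ω) P ∧ ∫ ω, 1 / Q ω ∂P = 1 / (κ * ((d : ℝ) - 2)) := by
  have hd' : (2 : ℝ) < d := by exact_mod_cast hd
  have ha : (1 : ℝ) < d / 2 := by linarith
  rw [chiSquared_eq_gammaMeasure (by omega)] at hQ
  have hfun : (fun ω => 1 / Q ω) = fun ω => κ⁻¹ * (Q ω / κ)⁻¹ := by
    funext ω
    field_simp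
  have hint := integrable_inv_gammaMeasure ha (one_half_pos (α := ℝ))
  rw [hfun]
  refine ⟨(hQ.integrable_comp hint).const_mul _, ?_⟩
  have h := hQ.integral_comp (f := fun x : ℝ => x⁻¹) (by fun_prop)
  simp only [Function.comp_def] at h
  rw [integral_const_mul, h, integral_inv_gammaMeasure ha one_half_pos]
  have : (d : ℝ) - 2 ≠ 0 := by linarith
  have : (d : ℝ) / 2 - 1 ≠ 0 := by linarith
  field_simp

lemma integrable_log_and_integral_eq [IsProbabilityMeasure P] (hκ : 0 < κ) (hd : 0 < d)
    (hQ : HasLaw (fun ω => Q ω / κ) (chiSquared d) P) :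
    Integrable (fun ω => Real.log (Q ω)) P ∧
      ((∫ ω, Real.log (Q ω) ∂P : ℝ) : ℂ) =
        ((Real.log κ + Real.log 2 : ℝ) : ℂ) + Complex.digamma ((d : ℂ) / 2) := by
  have ha : (0 : ℝ) < d / 2 := by positivity
  rw [chiSquared_eq_gammaMeasure hd] at hQ
  -- Splitting the logarithm needs `Q ≠ 0`, since `Real.log 0 = 0`; the gamma law has a density, so
  -- `0` is null.
  have hne : ∀ᵐ ω ∂P, Q ω / κ ≠ 0 := by
    refine (hQ.ae_iff (p := fun x => x ≠ 0)
      (measurableSet_setOfPred.1 (measurableSet_singleton 0).compl)).2 ?_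
    exact (withDensity_absolutelyContinuous _ _).ae_le (Measure.ae_ne volume 0)
  have hfun : (fun ω => Real.log (Q ω)) =ᵐ[P] fun ω => Real.log κ + Real.log (Q ω / κ) := by
    filter_upwards [hne] with ω hω
    rw [← Real.log_mul hκ.ne' hω, mul_div_cancel₀ _ hκ.ne']
  have hint := hQ.integrable_comp (integrable_log_gammaMeasure ha (one_half_pos (α := ℝ)))
  refine ⟨((integrable_const _).add hint).congr hfun.symm, ?_⟩
  have h := hQ.integral_comp (f := Real.log) (by fun_prop)
  simp only [Function.comp_def] at h
  rw [integral_congr_ae hfun, integral_add (integrable_const _) hint, h, Complex.ofReal_add,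
    integral_log_gammaMeasure ha one_half_pos, one_div, Real.log_inv]
  simp
  ring

end ScaledChiSquared

theorem lemma2 {𝕏 : Type*} [DecidableEq 𝕏] {n q p d : ℕ}
    (x : Fin n → 𝕏) (xbar : Fin q → 𝕏) (hx : IsUniqueTreatments x xbar) (hd : q + d = n)
    (f : 𝕏 → Fin p → ℝ) (μbar : Fin q → ℝ) (κ : ℝ) (hκ : 0 < κ)
    {Ω : Type*} [MeasurableSpace Ω] (P : Measure Ω) [IsProbabilityMeasure P]
    (y : Ω → EuclideanSpace ℝ (Fin n))
    (hy : HasLaw y (multivariateGaussian (WithLp.toLp 2 (treatmentMatrix x xbar *ᵥ μbar))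
      (κ • (1 : Matrix (Fin n) (Fin n) ℝ))) P) :
    IsUnit ((treatmentMatrix x xbar)ᵀ * treatmentMatrix x xbar) ∧
    (IsUnit ((modelMatrix f x)ᵀ * modelMatrix f x) →
      IndepFun (fun ω => quadForm (hatMatrix (modelMatrix f x)) (y ω))
        (fun ω => pureErrorForm x xbar (y ω)) P) ∧
    IndepFun (fun ω => (modelMatrix f x)ᵀ *ᵥ (y ω).ofLp)
      (fun ω => pureErrorForm x xbar (y ω)) P ∧
    HasLaw (fun ω => pureErrorForm x xbar (y ω) / κ) (chiSquared d) P ∧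
    (2 < d → Integrable (fun ω => 1 / pureErrorForm x xbar (y ω)) P ∧
      ∫ ω, 1 / pureErrorForm x xbar (y ω) ∂P = 1 / (κ * ((d : ℝ) - 2))) ∧
    (0 < d → Integrable (fun ω => Real.log (pureErrorForm x xbar (y ω))) P ∧
      ((∫ ω, Real.log (pureErrorForm x xbar (y ω)) ∂P : ℝ) : ℂ) =
        ((Real.log κ + Real.log 2 : ℝ) : ℂ) + Complex.digamma ((d : ℂ) / 2)) := by
  have hZ := isUnit_transpose_mul_treatmentMatrix hx
  have hQ := hasLaw_quadForm_div_chiSquared hZ hd μbar hκ hy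
  have hind : IndepFun (fun ω => (modelMatrix f x)ᵀ *ᵥ (y ω).ofLp)
      (fun ω => pureErrorForm x xbar (y ω)) P := by
    rw [modelMatrix_eq_treatmentMatrix_mul hx f]
    exact indepFun_mulVec_quadForm hZ _ hκ.le hy
  refine ⟨hZ, fun _ => ?_, hind, hQ, fun h => integrable_one_div_and_integral_eq hκ h hQ,
    fun h => integrable_log_and_integral_eq hκ h hQ⟩
  simp_rw [quadForm_hatMatrix]
  exact hind.comp (φ := fun w => w ⬝ᵥ (((modelMatrix f x)ᵀ * modelMatrix f x)⁻¹ *ᵥ w)) (ψ := id)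
    (by simp only [mulVec, dotProduct]; fun_prop) measurable_id
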